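/- Let $f:\mathbb R^n\times\mathbb R^m\to\mathbb R^n$ and $g:\mathbb R^n\times\mathbb R^m\times\mathbb R\to\mathbb R^m$ satisfy the following. (A1) $f$ is continuous and $\sup_{y}|f(x,y)|\le a+b|x|$ for all $x$, for some $a,b>0$; for every compact $K\subset\mathbb R^n\times\mathbb R^m$, $g$ is bounded and uniformly continuous on $K\times\mathbb R$; for all compact $K_0\subset\mathbb R^n$, $K\subset\mathbb R^m$ there is $L$ with $|g(x,y_1,\tau)-g(x,y_2,\tau)|\le L|y_1-y_2|$ for all $x\in K_0$, $y_1,y_2\in K$, $\tau\in\mathbb R$. Write $(h\cdot s)(x,y,\tau)=h(x,y,\tau+s)$, let $\mathcal H$ be the hull of $g$, i.e. the closure of $\{g\cdot s: s\in\mathbb R\}$ in the compact-open topology, let $d$ be any metric on $\mathcal H$ inducing this topology, and let $\mathcal O(g)\subset\mathcal H$ be the omega-limit set of $g$ for the flow $(s,h)\mapsto h\cdot s$. Denote by $y(\tau,h,x,y_0)$ the solution of $y'=h(x,y,\tau)$, $y(0)=y_0$. (A2) For all $h\in\mathcal H$, $x\in\mathbb R^n$, $y_0\in\mathbb R^m$,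 $y(\tau,h,x,y_0)$ is defined for all $\tau\ge0$; and for each compact $K_0\subset\mathbb R^n$ there is $c>0$ such that for every $\rho>0$ there is $T\ge 0$ such that every solution of $y'=g(x,y,\tau)$ on $[\tau_0,\infty)$ with $x\in K_0$, $\tau_0\in\mathbb R$, $|y(\tau_0)|\le\rho$ satisfies $|y(\tau_0+\tau)|\le c$ for all $\tau\ge T$. Fix $t_0>0$, $\xi\in\mathbb R^n$, $\eta\in\mathbb R^m$ and a sequence $\varepsilon_k>0$ with $\varepsilon_k\to0$. For each $k$ let $(x_{\varepsilon_k}(t),y_{\varepsilon_k}(t))$ be a solution on $[0,t_0]$ of $$\dot x=f(x,y),\qquad \varepsilon_k\,\dot y=g(x,y,t/\varepsilon_k),\qquad x(0)=\xi,\ y(0)=\eta,$$ and write $y_{\varepsilon_k}(\tau)$, $\tau=t/\varepsilon_k\in[0,t_0/\varepsilon_k]$, for the second component in the fast time (so that $y_{\varepsilon_k}(t_0/\varepsilon_k)$ is its value at slow time $t_0$). Assume that $x_{\varepsilon_k}(t)\to x_0(t)$ uniformly on $[0,t_0]$. Let $r>0$ and $K_0=\{x_0(t)+x: t\in[0,t_0],\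 |x|\le r\}$. Then the layered semiflow $\pi_\tau(h,x,y_0)=(h\cdot\tau,x,y(\tau,h,x,y_0))$, $\tau\ge0$, on $\mathcal H\times K_0\times\mathbb R^m$ has a global attractor $\mathbb A$, that is, a compact set with $\pi_\tau(\mathbb A)=\mathbb A$ for all $\tau\ge0$ and $\lim_{\tau\to\infty}\mathrm{dist}(\pi_\tau(\mathcal H\times K_0\times D),\mathbb A)=0$ for every bounded $D\subset\mathbb R^m$. Here $\mathrm{dist}(Y_1,Y_2)=\sup_{u\in Y_1}\inf_{v\in Y_2}\mathrm{d}(u,v)$ and products carry the maximum metric. Put $A_{(h,x)}=\{y:(h,x,y)\in\mathbb A\}$ and, for $\delta\ge0$, $$A_{(h,x)}[\delta]=\bigcup\big\{A_{(\tilde h,\tilde x)}:(\tilde h,\tilde x)\in\mathcal H\times K_0,\ \max\{d(\tilde h,h),|\tilde x-x|\}\le\delta\big\}.$$ For each $k$ the set $$\Delta_k=\big\{\delta>0:\ \mathrm{dist}\big(y_{\varepsilon_k}(t_0/\varepsilon_k),A_{(g\cdot(t_0/\varepsilon_k),x_0(t_0))}[\delta]\big)\le\delta\big\}$$ is nonempty,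 and with $\delta_k=\inf\Delta_k$ the following hold: (i) $\lim_{k\to\infty}\delta_k=0$; (ii) $\lim_{k\to\infty}\mathrm{dist}\big(y_{\varepsilon_k}(t_0/\varepsilon_k),A_{(g\cdot(t_0/\varepsilon_k),x_0(t_0))}[\delta_k]\big)=0$; (iii) if $g\cdot(t_0/\varepsilon_k)\to h_0$ in $(\mathcal H,d)$, then $h_0\in\mathcal O(g)$ and $\lim_{k\to\infty}\mathrm{dist}\big(y_{\varepsilon_k}(t_0/\varepsilon_k),A_{(h_0,x_0(t_0))}\big)=0$. -/

import Mathlib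

open Set Filter Topology
open scoped ENNReal

/-- The Euclidean space `ℝ^d`. -/
abbrev Euc (d : ℕ) : Type := EuclideanSpace ℝ (Fin d)

/-- Continuous maps `(x, y, τ) ↦ h(x, y, τ)` from `ℝⁿ × ℝᵐ × ℝ` to `ℝᵐ`, written as maps of
`((x, y), τ)`. Mathlib's topology on this type is the compact-open topology. A map that is uniformly
continuous on `K × ℝ` for every compact `K ⊆ ℝⁿ × ℝᵐ` is continuous, so that building continuity
into the type of `g` is no restriction. -/
abbrev FastField (n m : ℕ) : Type := C((Euc n × Euc m) × ℝ, Euc m)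

namespace SlowFast

variable {n m : ℕ}

/-! ### The hull of `g` -/

/-- The translate `(h·s)(x, y, τ) = h(x, y, τ + s)`. -/
def timeTranslate (h : FastField n m) (s : ℝ) : FastField n m :=
  h.comp ⟨fun p => (p.1, p.2 + s), by fun_prop⟩

/-- The hull of `g`: the closure of the set of its translates in the compact-open topology. -/
def hull (g : FastField n m) : Set (FastField n m) :=
  closure (range (timeTranslate g))

theorem timeTranslate_mem_hull {g h : FastField n m} (hh : h ∈ hull g) (s : ℝ) :
    timeTranslate h s ∈ hull g := by
  have hc : Continuous fun k : FastField n m => timeTranslate k s :=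
    ContinuousMap.continuous_precomp _
  refine map_mem_closure (f := fun k : FastField n m => timeTranslate k s) hc hh ?_
  rintro _ ⟨r, rfl⟩
  refine ⟨s + r, ?_⟩
  ext1 p
  simp [timeTranslate, add_assoc]

theorem self_mem_hull (g : FastField n m) : g ∈ hull g := by
  refine subset_closure ⟨0, ?_⟩
  ext1 p
  simp [timeTranslate]

/-- `g` as a point of its hull. -/
def base (g : FastField n m) : hull g := ⟨g, self_mem_hull g⟩

/-- The shift flow `(s, h) ↦ h·s` on the hull. -/
def shift {g : FastField n m} (s : ℝ) (h : hull g) : hull g :=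
  ⟨timeTranslate h.1 s, timeTranslate_mem_hull h.2 s⟩

/-- The omega-limit set `O(g)` of `g` for the shift flow. -/
def omegaSet (g : FastField n m) : Set (hull g) :=
  omegaLimit atTop (fun (s : ℝ) (h : hull g) => shift s h) {base g}

/-- `d` is (the distance function of) a metric inducing the given topology. -/
def IsCompatibleMetric {X : Type*} [t : TopologicalSpace X] (d : X → X → ℝ) : Prop :=
  ∃ M : MetricSpace X,
    M.toPseudoMetricSpace.toUniformSpace.toTopologicalSpace = t ∧ ∀ a b, M.dist a b = d a b

/-! ### Layer equations and the slow-fast system -/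

/-- `y` solves the layer equation `y' = h(x, y, τ)` on `[τ₀, ∞)`, for the fixed parameter `x`. -/
def IsLayerSolution (h : FastField n m) (x : Euc n) (τ₀ : ℝ) (y : ℝ → Euc m) : Prop :=
  ∀ τ ∈ Ici τ₀, HasDerivWithinAt y (h ((x, y τ), τ)) (Ici τ₀) τ

/-- `(x, y)` solves, on the slow time interval `[0, t₀]`, the initial value problem
`x' = f(x, y)`, `ε y' = g(x, y, t/ε)`, `x(0) = ξ`, `y(0) = η`. -/
structure IsSlowFastSolution (f : Euc n → Euc m → Euc n) (g : FastField n m)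
    (ξ : Euc n) (η : Euc m) (t₀ ε : ℝ) (x : ℝ → Euc n) (y : ℝ → Euc m) : Prop where
  x_zero : x 0 = ξ
  y_zero : y 0 = η
  slow : ∀ t ∈ Icc 0 t₀, HasDerivWithinAt x (f (x t) (y t)) (Icc 0 t₀) t
  fast : ∀ t ∈ Icc 0 t₀, ∃ v : Euc m,
    HasDerivWithinAt y v (Icc 0 t₀) t ∧ ε • v = g ((x t, y t), t / ε)

/-- A function of the slow time `t` written in the fast time `τ = t / ε`. -/
def inFastTime {E : Type*} (ε : ℝ) (y : ℝ → E) (τ : ℝ) : E := y (ε * τ)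

/-! ### Standing assumptions -/

/-- Regularity of `f` and `g`. -/
structure RegularityAssumption (f : Euc n → Euc m → Euc n) (g : FastField n m) : Prop where
  continuous_f : Continuous fun p : Euc n × Euc m => f p.1 p.2
  growth_f : ∃ a b : ℝ, 0 < a ∧ 0 < b ∧ ∀ x y, ‖f x y‖ ≤ a + b * ‖x‖
  bounded_g : ∀ K : Set (Euc n × Euc m), IsCompact K →
    ∃ C : ℝ, ∀ p ∈ K ×ˢ (univ : Set ℝ), ‖g p‖ ≤ C
  uniformContinuous_g : ∀ K : Set (Euc n × Euc m), IsCompact K →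
    UniformContinuousOn g (K ×ˢ (univ : Set ℝ))
  lipschitz_g : ∀ K₀ : Set (Euc n), IsCompact K₀ → ∀ K : Set (Euc m), IsCompact K →
    ∃ L : ℝ, ∀ y₁ ∈ K, ∀ y₂ ∈ K, ∀ x ∈ K₀, ∀ τ : ℝ,
      ‖g ((x, y₁), τ) - g ((x, y₂), τ)‖ ≤ L * ‖y₁ - y₂‖

/-- The solutions of the family `y' = g(x, y, τ)`, `x ∈ K₀`, are uniformly ultimately bounded. -/
def UniformlyUltimatelyBounded (g : FastField n m) (K₀ : Set (Euc n)) : Prop :=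
  ∃ c : ℝ, 0 < c ∧ ∀ d : ℝ, 0 < d → ∃ T : ℝ, 0 ≤ T ∧
    ∀ x ∈ K₀, ∀ (τ₀ : ℝ) (y : ℝ → Euc m), IsLayerSolution g x τ₀ y → ‖y τ₀‖ ≤ d →
      ∀ τ ≥ T, ‖y (τ + τ₀)‖ ≤ c

/-- Global existence in the future of the solutions of all layer equations over the hull, and
uniform ultimate boundedness over compact sets of parameters. -/
structure DissipativityAssumption (g : FastField n m) : Prop where
  global_existence : ∀ h ∈ hull g, ∀ (x : Euc n) (y₀ : Euc m),
    ∃ y : ℝ → Euc m, IsLayerSolution h x 0 y ∧ y 0 = y₀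
  ultimately_bounded : ∀ K₀ : Set (Euc n), IsCompact K₀ → UniformlyUltimatelyBounded g K₀

/-! ### The layered semiflow and its global attractor -/

/-- `τ ↦ y(τ, h, x, y₀)`, `τ ≥ 0`: the solution of `y' = h(x, y, τ)` with `y(0) = y₀` (it exists
and is unique on `[0, ∞)` under the standing assumptions). -/
noncomputable def layerSolution (h : FastField n m) (x : Euc n) (y₀ : Euc m) : ℝ → Euc m :=
  Classical.epsilon fun y : ℝ → Euc m => IsLayerSolution h x 0 y ∧ y 0 = y₀

/-- The layered semiflow `π_τ(h, x, y₀) = (h·τ, x, y(τ, h, x, y₀))`, `τ ≥ 0`. -/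
noncomputable def layeredSemiflow (g : FastField n m) (τ : ℝ) (p : hull g × Euc n × Euc m) :
    hull g × Euc n × Euc m :=
  (shift τ p.1, p.2.1, layerSolution p.1.1 p.2.1 p.2.2 τ)

/-- The maximum metric on `H × ℝⁿ × ℝᵐ`, given the metric `d` on `H`. -/
noncomputable def prodDist {g : FastField n m} (d : hull g → hull g → ℝ)
    (p q : hull g × Euc n × Euc m) : ℝ :=
  max (d p.1 q.1) (max ‖p.2.1 - q.2.1‖ ‖p.2.2 - q.2.2‖)

/-- The Hausdorff semidistance `sup_{a ∈ S} inf_{b ∈ B} ρ(a, b)`. -/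
noncomputable def semidist {X : Type*} (ρ : X → X → ℝ) (S B : Set X) : ℝ≥0∞ :=
  ⨆ a ∈ S, ⨅ b ∈ B, ENNReal.ofReal (ρ a b)

/-- `A` is the global attractor of the layered semiflow on `H × K₀ × ℝᵐ`: a compact invariant
subset that attracts `H × K₀ × D` for every bounded `D ⊆ ℝᵐ`. -/
structure IsGlobalAttractor (g : FastField n m) (d : hull g → hull g → ℝ) (K₀ : Set (Euc n))
    (A : Set (hull g × Euc n × Euc m)) : Prop where
  subset : ∀ p ∈ A, p.2.1 ∈ K₀
  compact : IsCompact A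
  invariant : ∀ τ : ℝ, 0 ≤ τ → layeredSemiflow g τ '' A = A
  attracts : ∀ D : Set (Euc m), Bornology.IsBounded D →
    Tendsto (fun τ : ℝ =>
      semidist (prodDist d) (layeredSemiflow g τ '' (univ ×ˢ K₀ ×ˢ D)) A) atTop (𝓝 0)

/-- The section `A_{(h,x)}`. -/
def fiber {g : FastField n m} (A : Set (hull g × Euc n × Euc m)) (h : hull g) (x : Euc n) :
    Set (Euc m) :=
  {y | (h, x, y) ∈ A}

/-- The parametrically inflated fiber `A_{(h,x)}[δ]`: the union of the `A_{(h',x')}` over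
`(h', x') ∈ H × K₀` at distance at most `δ` from `(h, x)`, for the maximum metric. -/
def inflatedFiber {g : FastField n m} (d : hull g → hull g → ℝ) (K₀ : Set (Euc n))
    (A : Set (hull g × Euc n × Euc m)) (h : hull g) (x : Euc n) (δ : ℝ) : Set (Euc m) :=
  {y | ∃ h' : hull g, ∃ x' ∈ K₀, max (d h' h) ‖x' - x‖ ≤ δ ∧ y ∈ fiber A h' x'}

/-- The tube `{x₀(t) + x : t ∈ [0, t₀], |x| ≤ r}`. -/
def tube (x₀ : ℝ → Euc n) (t₀ r : ℝ) : Set (Euc n) :=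
  {z | ∃ t ∈ Icc 0 t₀, ∃ x : Euc n, ‖x‖ ≤ r ∧ z = x₀ t + x}

/-- The set of `δ > 0` with `dist(y, A_{(h,x)}[δ]) ≤ δ`. -/
def admissibleRadii {g : FastField n m} (d : hull g → hull g → ℝ) (K₀ : Set (Euc n))
    (A : Set (hull g × Euc n × Euc m)) (h : hull g) (x : Euc n) (y : Euc m) : Set ℝ :=
  {δ | 0 < δ ∧ Metric.infEDist y (inflatedFiber d K₀ A h x δ) ≤ ENNReal.ofReal δ}

end SlowFast

/-! During a fast-time window of bounded length the slow variable hardly moves, because the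
uniformly convergent curves `x k` are eventually equicontinuous. The fast motion therefore shadows
the layer solution with frozen `x` from the same initial value, uniformly in the starting time
(`eventually_norm_sub_layerSolution_lt`, by Grönwall). Chaining windows of a fixed length with
ultimate boundedness bounds the fast motion on all of `[0, t₀ / ε k]` (`exists_eventually_norm_le`).
For the final state only the last window matters: its length `S` is chosen so that the semiflow
brings all bounded data close to the attractor, hence the final state is close to `A` too
(`eventually_exists_prodDist_lt`).

The attractor exists because the hull is compact (Arzelà–Ascoli) and ultimate boundedness passes
from `g` to its hull, which gives a compact absorbing set.

The rest is geometry of a compact set. The infimum of the admissible radii is exactly the distance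
from the final state to `A` in the maximum metric (`sInf_admissibleRadii`), so it tends to zero; a
nearest point of `A` controls the inflated fiber, and upper semicontinuity of fibers gives the limit
statement. -/

/-- Two curves whose velocities differ by at most `L‖z - y‖ + μ` as long as they are `ρ`-close stay
`ρ`-close if the Grönwall bound does. -/
theorem norm_sub_lt_of_norm_deriv_sub_le {E : Type*} [NormedAddCommGroup E] [NormedSpace ℝ E]
    {y z y' z' : ℝ → E} {L μ ρ T : ℝ}
    (hy : ContinuousOn y (Icc 0 T)) (hz : ContinuousOn z (Icc 0 T))
    (hy' : ∀ s ∈ Ico 0 T, HasDerivWithinAt y (y' s) (Ici s) s)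
    (hz' : ∀ s ∈ Ico 0 T, HasDerivWithinAt z (z' s) (Ici s) s)
    (h0 : ‖z 0 - y 0‖ ≤ μ)
    (hb : ∀ s ∈ Ico 0 T, ‖z s - y s‖ ≤ ρ → ‖z' s - y' s‖ ≤ L * ‖z s - y s‖ + μ)
    (hμ : ∀ s ∈ Icc 0 T, gronwallBound μ L μ s < ρ) :
    ∀ s ∈ Icc 0 T, ‖z s - y s‖ < ρ := by
  by_contra! hcon
  have hc : ContinuousOn (fun s => ‖z s - y s‖) (Icc 0 T) := (hz.sub hy).norm
  have hC : IsCompact (Icc 0 T ∩ (fun s => ‖z s - y s‖) ⁻¹' Ici ρ) :=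
    isCompact_Icc.of_isClosed_subset (hc.preimage_isClosed_of_isClosed isClosed_Icc isClosed_Ici)
      inter_subset_left
  obtain ⟨s, hs, hsρ⟩ := hcon
  -- At the first time `s₁` where the distance reaches `ρ`, the velocity bound is available on all
  -- of `[0, s₁)`, so Grönwall contradicts the choice of `s₁`.
  obtain ⟨s₁, ⟨hs₁, hs₁ρ⟩, hmin⟩ := hC.exists_isLeast ⟨s, hs, hsρ⟩
  have hsub : Icc 0 s₁ ⊆ Icc 0 T := Icc_subset_Icc_right hs₁.2
  have hsub' : Ico 0 s₁ ⊆ Ico 0 T := Ico_subset_Ico_right hs₁.2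
  have hlt : ∀ t ∈ Ico 0 s₁, ‖z t - y t‖ ≤ ρ := by
    intro t ht
    by_contra! h
    exact absurd (hmin ⟨hsub ⟨ht.1, ht.2.le⟩, h.le⟩) (not_le.2 ht.2)
  have key := norm_le_gronwallBound_of_norm_deriv_right_le (f := fun t => z t - y t)
    (f' := fun t => z' t - y' t) ((hz.sub hy).mono hsub)
    (fun t ht => (hz' t (hsub' ht)).sub (hy' t (hsub' ht))) h0
    (fun t ht => hb t (hsub' ht) (hlt t ht)) s₁ ⟨hs₁.1, le_rfl⟩
  rw [sub_zero] at key
  exact absurd hs₁ρ (not_le.2 (key.trans_lt (hμ s₁ hs₁)))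

/-- The Grönwall bound is linear in `μ`, and `M` dominates its coefficient on `[0, T]`; the chosen
`μ` keeps it below `ρ / 2`. -/
theorem exists_gronwallBound_lt {L ρ : ℝ} (hL : 0 < L) (hρ : 0 < ρ) (T : ℝ) :
    ∃ μ > 0, ∀ s ∈ Icc 0 T, gronwallBound μ L μ s < ρ := by
  set M : ℝ := Real.exp (L * T) + Real.exp (L * T) / L with hM
  have hM0 : 0 < M := by positivity
  refine ⟨ρ / (2 * M), by positivity, fun s hs => ?_⟩
  rw [gronwallBound_of_K_ne_0 hL.ne']
  have he : Real.exp (L * s) ≤ Real.exp (L * T) :=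
    Real.exp_le_exp.2 (mul_le_mul_of_nonneg_left hs.2 hL.le)
  set μ := ρ / (2 * M) with hμ
  have hμ0 : 0 < μ := by positivity
  calc μ * Real.exp (L * s) + μ / L * (Real.exp (L * s) - 1)
      ≤ μ * Real.exp (L * T) + μ / L * Real.exp (L * T) := by
        gcongr
        linarith
    _ = μ * M := by rw [hM]; ring
    _ = ρ / 2 := by rw [hμ]; field_simp
    _ < ρ := by linarith

namespace SlowFast

variable {n m : ℕ}

/-! ### Compactness and regularity of the hull -/

/-- Arzelà–Ascoli: uniform continuity and boundedness on `K × ℝ` do not see time shifts, so the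
translates of `g` are equicontinuous and pointwise bounded. -/
theorem isCompact_hull {g : FastField n m}
    (hb : ∀ K : Set (Euc n × Euc m), IsCompact K → ∃ C : ℝ, ∀ p ∈ K ×ˢ (univ : Set ℝ), ‖g p‖ ≤ C)
    (huc : ∀ K : Set (Euc n × Euc m), IsCompact K →
      UniformContinuousOn g (K ×ˢ (univ : Set ℝ))) : IsCompact (hull g) := by
  have hemb : IsClosedEmbedding (UniformOnFun.ofFun {K : Set ((Euc n × Euc m) × ℝ) | IsCompact K} ∘
      (fun f : FastField n m => (f : (Euc n × Euc m) × ℝ → Euc m))) := by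
    refine ⟨ContinuousMap.isUniformEmbedding_toUniformOnFunIsCompact.isEmbedding, ?_⟩
    have := ContinuousMap.range_toUniformOnFunIsCompact (α := (Euc n × Euc m) × ℝ) (β := Euc m)
    have h2 : IsClosed (range (ContinuousMap.toUniformOnFunIsCompact :
        FastField n m → _)) := by
      rw [this]
      exact UniformOnFun.isClosed_setOfPred_continuous
        CompactlyCoherentSpace.isCoherentWith
    exact h2
  refine ArzelaAscoli.isCompact_closure_of_isClosedEmbedding (fun K hK => hK) hemb ?_ ?_
  · intro K _
    refine Equicontinuous.equicontinuousOn ?_ K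
    intro p
    rw [Metric.equicontinuousAt_iff]
    intro e he
    have hu := Metric.uniformContinuousOn_iff.1 (huc _ (isCompact_closedBall p.1 1)) e he
    obtain ⟨δ, hδ, hu⟩ := hu
    refine ⟨min δ 1, by positivity, ?_⟩
    rintro q hq ⟨_, s, rfl⟩
    have hq' : dist q.1 p.1 < min δ 1 := (le_max_left _ _).trans_lt hq
    refine hu (p.1, p.2 + s) ⟨Metric.mem_closedBall_self zero_le_one, trivial⟩ (q.1, q.2 + s)
      ⟨?_, trivial⟩ ?_
    · exact (hq'.trans_le (min_le_right _ _)).le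
    · rw [dist_comm, Prod.dist_eq]
      have : dist (q.2 + s) (p.2 + s) = dist q.2 p.2 := dist_add_right _ _ _
      simp only [this]
      exact lt_of_lt_of_le hq (min_le_left _ _)
  · rintro K - p -
    obtain ⟨C, hC⟩ := hb {p.1} isCompact_singleton
    refine ⟨Metric.closedBall 0 C, isCompact_closedBall _ _, ?_⟩
    rintro _ ⟨s, rfl⟩
    rw [mem_closedBall_zero_iff]
    exact hC (p.1, p.2 + s) ⟨rfl, trivial⟩

/-- A Lipschitz bound for `g` in `y`, uniform in time, passes to the hull. -/
theorem norm_sub_le_of_mem_hull {g : FastField n m} {L : ℝ} {x : Euc n} {y₁ y₂ : Euc m}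
    (hL : ∀ τ : ℝ, ‖g ((x, y₁), τ) - g ((x, y₂), τ)‖ ≤ L * ‖y₁ - y₂‖)
    {h : FastField n m} (hh : h ∈ hull g) (τ : ℝ) :
    ‖h ((x, y₁), τ) - h ((x, y₂), τ)‖ ≤ L * ‖y₁ - y₂‖ := by
  have hc : IsClosed {h : FastField n m |
      ‖h ((x, y₁), τ) - h ((x, y₂), τ)‖ ≤ L * ‖y₁ - y₂‖} := by
    refine isClosed_le ?_ continuous_const
    exact ((continuous_eval_const _).sub
      (continuous_eval_const _)).norm
  refine closure_minimal ?_ hc hh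
  rintro _ ⟨s, rfl⟩
  exact hL (τ + s)

theorem shift_continuous (g : FastField n m) (s : ℝ) :
    Continuous (shift s : hull g → hull g) := by
  refine Continuous.subtype_mk ?_ _
  exact (ContinuousMap.continuous_precomp _).comp continuous_subtype_val

theorem shift_add {g : FastField n m} (s t : ℝ) (h : hull g) :
    shift s (shift t h) = shift (s + t) h := by
  refine Subtype.ext (ContinuousMap.ext fun p => ?_)
  simp [shift, timeTranslate, add_assoc]

/-! ### Layer solutions -/

theorem IsLayerSolution.continuousOn {h : FastField n m} {x : Euc n} {τ₀ : ℝ} {y : ℝ → Euc m}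
    (hy : IsLayerSolution h x τ₀ y) : ContinuousOn y (Ici τ₀) :=
  fun t ht => (hy t ht).continuousWithinAt

theorem IsLayerSolution.comp_add {h : FastField n m} {x : Euc n} {τ₀ : ℝ} {y : ℝ → Euc m}
    (hy : IsLayerSolution h x τ₀ y) {s : ℝ} (hs : τ₀ ≤ s) :
    IsLayerSolution (timeTranslate h s) x 0 (fun t => y (t + s)) := by
  intro t ht
  have h1 := hy (t + s) (by simp only [mem_Ici] at *; linarith)
  have h2 : HasDerivWithinAt (fun t : ℝ => t + s) 1 (Ici 0) t :=
    ((hasDerivAt_id t).add_const s).hasDerivWithinAt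
  have := h1.scomp t h2 (fun u hu => by simp only [mem_Ici] at *; linarith)
  simpa [timeTranslate] using! this

theorem IsLayerSolution.of_timeTranslate {h : FastField n m} {x : Euc n} {s : ℝ} {y : ℝ → Euc m}
    (hy : IsLayerSolution (timeTranslate h s) x 0 y) :
    IsLayerSolution h x s (fun t => y (t - s)) := by
  intro t ht
  have h1 := hy (t - s) (by simpa using ht)
  have h2 : HasDerivWithinAt (fun t : ℝ => t - s) 1 (Ici s) t :=
    ((hasDerivAt_id t).sub_const s).hasDerivWithinAt
  have := h1.scomp t h2 (fun u hu => by simpa using hu)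
  simpa [timeTranslate] using! this

/-- Continuous dependence of layer solutions on the field, the parameter and the initial value. -/
theorem IsLayerSolution.eventually_norm_sub_lt {h : FastField n m} {x : Euc n} {y : ℝ → Euc m}
    (hlip : ∀ K : Set (Euc m), IsCompact K → ∃ L : ℝ, ∀ y₁ ∈ K, ∀ y₂ ∈ K, ∀ τ : ℝ,
      ‖h ((x, y₁), τ) - h ((x, y₂), τ)‖ ≤ L * ‖y₁ - y₂‖)
    (hy : IsLayerSolution h x 0 y) (S : ℝ) {ρ : ℝ} (hρ : 0 < ρ) :
    ∀ᶠ p : FastField n m × Euc n × Euc m in 𝓝 (h, x, y 0), ∀ z : ℝ → Euc m,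
      IsLayerSolution p.1 p.2.1 0 z → z 0 = p.2.2 → ∀ s ∈ Icc 0 S, ‖z s - y s‖ < ρ := by
  have hyc : ContinuousOn y (Icc 0 S) := hy.continuousOn.mono Icc_subset_Ici_self
  -- This compact neighbourhood of the trajectory contains `z` as long as it stays `ρ`-close, so the
  -- fields need only be compared there.
  have hK : IsCompact (Metric.cthickening ρ (y '' Icc 0 S)) :=
    (isCompact_Icc.image_of_continuousOn hyc).cthickening
  obtain ⟨L, hL⟩ := hlip _ hK
  obtain ⟨μ, hμ, hG⟩ := exists_gronwallBound_lt (lt_of_lt_of_le one_pos (le_max_right L 1)) hρ S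
  have h1 : ∀ᶠ p : FastField n m × Euc n × Euc m in 𝓝 (h, x, y 0),
      ∀ q ∈ Metric.cthickening ρ (y '' Icc 0 S) ×ˢ Icc 0 S,
        ‖p.1 ((p.2.1, q.1), q.2) - h ((x, q.1), q.2)‖ < μ := by
    refine (hK.prod isCompact_Icc).eventually_forall_of_forall_eventually ?_
    intro q _
    have hc : Continuous fun z : (FastField n m × Euc n × Euc m) × (Euc m × ℝ) =>
        ‖z.1.1 ((z.1.2.1, z.2.1), z.2.2) - h ((x, z.2.1), z.2.2)‖ := by fun_prop
    refine hc.continuousAt.eventually_lt continuousAt_const ?_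
    simpa using hμ
  have h2 : ∀ᶠ p : FastField n m × Euc n × Euc m in 𝓝 (h, x, y 0), ‖p.2.2 - y 0‖ < μ := by
    have hc : Continuous fun p : FastField n m × Euc n × Euc m => ‖p.2.2 - y 0‖ := by fun_prop
    refine hc.continuousAt.eventually_lt continuousAt_const ?_
    simpa using hμ
  filter_upwards [h1, h2] with p hp1 hp2 z hz hz0
  refine norm_sub_lt_of_norm_deriv_sub_le (L := max L 1) (μ := μ) hyc
    (hz.continuousOn.mono Icc_subset_Ici_self)
    (fun s hs => (hy s hs.1).mono (Ici_subset_Ici.2 hs.1))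
    (fun s hs => (hz s hs.1).mono (Ici_subset_Ici.2 hs.1)) (by rw [hz0]; exact hp2.le) ?_ hG
  intro s hs hzs
  have hsI : s ∈ Icc 0 S := ⟨hs.1, hs.2.le⟩
  have hmy : y s ∈ Metric.cthickening ρ (y '' Icc 0 S) :=
    Metric.self_subset_cthickening _ (mem_image_of_mem y hsI)
  have hmz : z s ∈ Metric.cthickening ρ (y '' Icc 0 S) :=
    Metric.mem_cthickening_of_dist_le _ _ _ _ (mem_image_of_mem y hsI) (by rwa [dist_eq_norm])
  calc ‖p.1 ((p.2.1, z s), s) - h ((x, y s), s)‖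
      ≤ ‖p.1 ((p.2.1, z s), s) - h ((x, z s), s)‖ + ‖h ((x, z s), s) - h ((x, y s), s)‖ :=
        norm_sub_le_norm_sub_add_norm_sub _ _ _
    _ ≤ μ + max L 1 * ‖z s - y s‖ := by
        refine add_le_add (hp1 (z s, s) ⟨hmz, hsI⟩).le ((hL _ hmz _ hmy s).trans ?_)
        gcongr
        exact le_max_left _ _
    _ = _ := add_comm _ _

end SlowFast

/-! ### Attractors of semiflows with a compact absorbing set. -/

/-- A semiflow of continuous maps that eventually maps a compact set `B` into itself has a compact
invariant set in `B` every neighbourhood of which contains the image of `B` at some time. -/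
theorem exists_isCompact_invariant_subset {X : Type*} [TopologicalSpace X] [T2Space X]
    {φ : ℝ → X → X} (hc : ∀ t, 0 ≤ t → Continuous (φ t))
    (hadd : ∀ s, 0 ≤ s → ∀ t, 0 ≤ t → ∀ p, φ (s + t) p = φ s (φ t p))
    {B : Set X} (hB : IsCompact B) {T : ℝ} (hT : 0 ≤ T) (hmaps : ∀ s, T ≤ s → MapsTo (φ s) B B) :
    ∃ A ⊆ B, IsCompact A ∧ (∀ t, 0 ≤ t → φ t '' A = A) ∧
      ∀ U, IsOpen U → A ⊆ U → ∃ s, 0 ≤ s ∧ φ s '' B ⊆ U := by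
  let V : Ici (0 : ℝ) → Set X := fun t => φ t '' B
  have hVc : ∀ t, IsCompact (V t) := fun t => hB.image (hc t t.2)
  -- `B` is mapped into itself only from time `T` on, so the images decrease only after a delay `T`.
  have hmono : ∀ s t : Ici (0 : ℝ), (s : ℝ) + T ≤ t → V t ⊆ V s := by
    rintro s t hst _ ⟨b, hb, rfl⟩
    refine ⟨φ (t - s) b, hmaps _ (by linarith) hb, ?_⟩
    rw [← hadd s s.2 _ (by linarith)]
    congr 1
    ring
  have hdir : Directed (· ⊇ ·) V := by
    intro s t
    have hs : (0 : ℝ) ≤ s := s.2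
    have ht : (0 : ℝ) ≤ t := t.2
    exact ⟨⟨s + t + T, by simp only [mem_Ici]; linarith⟩, hmono _ _ (by simp only; linarith),
      hmono _ _ (by simp only; linarith)⟩
  have : Nonempty (Ici (0 : ℝ)) := ⟨⟨0, mem_Ici.2 le_rfl⟩⟩
  have hAB : (⋂ t, V t) ⊆ B := by
    refine (iInter_subset V ⟨T, hT⟩).trans ?_
    rintro _ ⟨b, hb, rfl⟩
    exact hmaps T le_rfl hb
  refine ⟨⋂ t, V t, hAB, hB.of_isClosed_subset (isClosed_iInter fun t => (hVc t).isClosed) hAB,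
    fun τ hτ => Subset.antisymm ?_ ?_, fun U hU hAU => ?_⟩
  · rintro _ ⟨p, hp, rfl⟩
    refine mem_iInter.2 fun t => ?_
    have ht : (0 : ℝ) ≤ t := t.2
    obtain ⟨b, hb, rfl⟩ := mem_iInter.1 hp ⟨t + T, by simp only [mem_Ici]; linarith⟩
    refine ⟨φ (τ + T) b, hmaps _ (by linarith) hb, ?_⟩
    rw [← hadd t t.2 _ (by linarith), ← hadd τ hτ _ (by simp only; linarith)]
    congr 1
    simp only
    ring
  -- A preimage of `p` in the intersection exists because the sets `V t ∩ φ τ ⁻¹' {p}` are compact,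
  -- nonempty and directed.
  · intro p hp
    have hcl : IsClosed (φ τ ⁻¹' {p}) := isClosed_singleton.preimage (hc τ hτ)
    obtain ⟨q, hq⟩ := IsCompact.nonempty_iInter_of_directed_nonempty_isCompact_isClosed
      (fun t => V t ∩ φ τ ⁻¹' {p})
      (fun s t => by
        obtain ⟨u, hu, hu'⟩ := hdir s t
        exact ⟨u, inter_subset_inter_left _ hu, inter_subset_inter_left _ hu'⟩)
      (fun t => by
        have ht : (0 : ℝ) ≤ t := t.2
        obtain ⟨b, hb, hbp⟩ := mem_iInter.1 hp ⟨τ + t, add_nonneg hτ ht⟩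
        exact ⟨φ t b, mem_image_of_mem _ hb, by
          rw [mem_preimage, mem_singleton_iff, ← hbp, ← hadd τ hτ t ht]⟩)
      (fun t => (hVc t).inter_right hcl) (fun t => (hVc t).isClosed.inter hcl)
    rw [mem_iInter] at hq
    exact ⟨q, mem_iInter.2 fun t => (hq t).1, (hq ⟨0, mem_Ici.2 le_rfl⟩).2⟩
  · obtain ⟨s, hs⟩ := exists_subset_nhds_of_isCompact hdir hVc
      (fun p hp => hU.mem_nhds (hAU hp))
    exact ⟨s, s.2, hs⟩

/-! ### The layered semiflow: uniqueness, continuity, uniform bounds. -/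

namespace SlowFast

variable {n m : ℕ} {f : Euc n → Euc m → Euc n} {g : FastField n m}

theorem RegularityAssumption.lipschitz_of_mem_hull (hreg : RegularityAssumption f g)
    {h : FastField n m} (hh : h ∈ hull g) (x : Euc n) (K : Set (Euc m)) (hK : IsCompact K) :
    ∃ L : ℝ, ∀ y₁ ∈ K, ∀ y₂ ∈ K, ∀ τ : ℝ,
      ‖h ((x, y₁), τ) - h ((x, y₂), τ)‖ ≤ L * ‖y₁ - y₂‖ := by
  obtain ⟨L, hL⟩ := hreg.lipschitz_g {x} isCompact_singleton K hK
  exact ⟨L, fun y₁ h₁ y₂ h₂ => norm_sub_le_of_mem_hull (hL y₁ h₁ y₂ h₂ x rfl) hh⟩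

theorem DissipativityAssumption.layerSolution_spec (hdis : DissipativityAssumption g)
    {h : FastField n m} (hh : h ∈ hull g) (x : Euc n) (y₀ : Euc m) :
    IsLayerSolution h x 0 (layerSolution h x y₀) ∧ layerSolution h x y₀ 0 = y₀ :=
  Classical.epsilon_spec (hdis.global_existence h hh x y₀)

/-- Continuous dependence quantifies over all solutions `z`, so its unperturbed case, for every
tolerance, is uniqueness. -/
theorem RegularityAssumption.layerSolution_unique (hreg : RegularityAssumption f g)
    {h : FastField n m} (hh : h ∈ hull g) {x : Euc n} {y z : ℝ → Euc m}
    (hy : IsLayerSolution h x 0 y) (hz : IsLayerSolution h x 0 z) (h0 : z 0 = y 0)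
    {s : ℝ} (hs : 0 ≤ s) : z s = y s := by
  refine eq_of_forall_dist_le fun e he => ?_
  have := (hy.eventually_norm_sub_lt (hreg.lipschitz_of_mem_hull hh x) s he).self_of_nhds
    z hz h0 s ⟨hs, le_rfl⟩
  rw [dist_eq_norm]
  exact this.le

/-- Near a point of the phase space, layer solutions are uniformly close on `[0, S]`. -/
theorem eventually_layerSolution_norm_sub_lt (hreg : RegularityAssumption f g)
    (hdis : DissipativityAssumption g) (p : hull g × Euc n × Euc m) (S : ℝ) {ρ : ℝ} (hρ : 0 < ρ) :
    ∀ᶠ q : hull g × Euc n × Euc m in 𝓝 p, ∀ s ∈ Icc 0 S,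
      ‖layerSolution q.1.1 q.2.1 q.2.2 s - layerSolution p.1.1 p.2.1 p.2.2 s‖ < ρ := by
  obtain ⟨hy, hy0⟩ := hdis.layerSolution_spec p.1.2 p.2.1 p.2.2
  have h := hy.eventually_norm_sub_lt (hreg.lipschitz_of_mem_hull p.1.2 p.2.1) S hρ
  rw [hy0] at h
  have hc : Continuous fun q : hull g × Euc n × Euc m => ((q.1.1, q.2.1, q.2.2) :
      FastField n m × Euc n × Euc m) := by fun_prop
  filter_upwards [hc.continuousAt.eventually h] with q hq
  obtain ⟨hz, hz0⟩ := hdis.layerSolution_spec q.1.2 q.2.1 q.2.2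
  exact hq _ hz hz0

theorem continuous_layeredSemiflow (hreg : RegularityAssumption f g)
    (hdis : DissipativityAssumption g) {τ : ℝ} (hτ : 0 ≤ τ) : Continuous (layeredSemiflow g τ) := by
  refine ((shift_continuous g τ).comp continuous_fst).prodMk
    ((continuous_fst.comp continuous_snd).prodMk ?_)
  refine continuous_iff_continuousAt.2 fun p => Metric.tendsto_nhds.2 fun e he => ?_
  filter_upwards [eventually_layerSolution_norm_sub_lt hreg hdis p τ he] with q hq
  rw [dist_eq_norm]
  exact hq τ ⟨hτ, le_rfl⟩

theorem layeredSemiflow_add (hreg : RegularityAssumption f g) (hdis : DissipativityAssumption g)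
    {s t : ℝ} (hs : 0 ≤ s) (ht : 0 ≤ t) (p : hull g × Euc n × Euc m) :
    layeredSemiflow g (s + t) p = layeredSemiflow g s (layeredSemiflow g t p) := by
  obtain ⟨hy, hy0⟩ := hdis.layerSolution_spec p.1.2 p.2.1 p.2.2
  obtain ⟨hz, hz0⟩ := hdis.layerSolution_spec (shift t p.1).2 p.2.1
    (layerSolution p.1.1 p.2.1 p.2.2 t)
  refine Prod.ext (shift_add s t p.1).symm (Prod.ext rfl ?_)
  exact hreg.layerSolution_unique (shift t p.1).2 hz (hy.comp_add ht)
    (by rw [hz0, zero_add]) hs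

theorem isCompact_univ_hull (hreg : RegularityAssumption f g) :
    IsCompact (univ : Set (hull g)) :=
  isCompact_iff_isCompact_univ.1 (isCompact_hull hreg.bounded_g hreg.uniformContinuous_g)

/-- Locally, layer solutions stay within 1 of a single one that is bounded on `[0, S]`; compactness
of hull, parameters and initial values makes the bound global. -/
theorem exists_layerSolution_bound (hreg : RegularityAssumption f g)
    (hdis : DissipativityAssumption g) {K₀ : Set (Euc n)} (hK₀ : IsCompact K₀) (ρ S : ℝ) :
    ∃ R : ℝ, ∀ h : hull g, ∀ x ∈ K₀, ∀ y₀ : Euc m, ‖y₀‖ ≤ ρ → ∀ s ∈ Icc 0 S,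
      ‖layerSolution h.1 x y₀ s‖ ≤ R := by
  have hQ : IsCompact ((univ : Set (hull g)) ×ˢ K₀ ×ˢ Metric.closedBall (0 : Euc m) ρ) :=
    (isCompact_univ_hull hreg).prod (hK₀.prod (isCompact_closedBall _ _))
  have key : ∃ R : ℝ, ∀ q ∈ (univ : Set (hull g)) ×ˢ K₀ ×ˢ Metric.closedBall (0 : Euc m) ρ,
      ∀ s ∈ Icc 0 S, ‖layerSolution q.1.1 q.2.1 q.2.2 s‖ ≤ R := by
    refine hQ.induction_on (p := fun Q => ∃ R : ℝ, ∀ q ∈ Q,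
      ∀ s ∈ Icc 0 S, ‖layerSolution q.1.1 q.2.1 q.2.2 s‖ ≤ R) ⟨0, by simp⟩ ?_ ?_ ?_
    · rintro Q Q' hQQ' ⟨R, hR⟩
      exact ⟨R, fun q hq => hR q (hQQ' hq)⟩
    · rintro Q Q' ⟨R, hR⟩ ⟨R', hR'⟩
      refine ⟨max R R', ?_⟩
      rintro q (hq | hq) s hs
      · exact (hR q hq s hs).trans (le_max_left _ _)
      · exact (hR' q hq s hs).trans (le_max_right _ _)
    · intro p _
      obtain ⟨hy, -⟩ := hdis.layerSolution_spec p.1.2 p.2.1 p.2.2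
      obtain ⟨C, hC⟩ := isCompact_Icc.exists_bound_of_continuousOn
        (s := Icc 0 S) (hy.continuousOn.mono Icc_subset_Ici_self)
      refine ⟨_, mem_nhdsWithin_of_mem_nhds
        (eventually_layerSolution_norm_sub_lt hreg hdis p S one_pos), C + 1, fun q hq s hs => ?_⟩
      have h1 := hq s hs
      have h2 := hC s hs
      have h3 := norm_le_norm_add_norm_sub' (layerSolution q.1.1 q.2.1 q.2.2 s)
        (layerSolution p.1.1 p.2.1 p.2.2 s)
      linarith
  obtain ⟨R, hR⟩ := key
  exact ⟨R, fun h x hx y₀ hy₀ => hR (h, x, y₀) ⟨trivial, hx, mem_closedBall_zero_iff.2 hy₀⟩⟩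

/-- Uniform ultimate boundedness passes from `g` to its hull. -/
theorem exists_layerSolution_ultimate_bound (hreg : RegularityAssumption f g)
    (hdis : DissipativityAssumption g) {K₀ : Set (Euc n)} (hK₀ : IsCompact K₀) :
    ∃ c : ℝ, 0 < c ∧ ∀ ρ : ℝ, 0 < ρ → ∃ T : ℝ, 0 ≤ T ∧ ∀ h : hull g, ∀ x ∈ K₀, ∀ y₀ : Euc m,
      ‖y₀‖ ≤ ρ → ∀ τ ≥ T, ‖layerSolution h.1 x y₀ τ‖ ≤ c := by
  obtain ⟨c, hc, H⟩ := hdis.ultimately_bounded K₀ hK₀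
  refine ⟨c, hc, fun ρ hρ => ?_⟩
  obtain ⟨T, hT, H⟩ := H ρ hρ
  refine ⟨T, hT, fun h x hx y₀ hy₀ τ hτ => ?_⟩
  -- A layer solution for a translate of `g` is a solution for `g` started at time `s`; here the
  -- uniformity in the initial time enters.
  have htr : ∀ s : ℝ, ‖layerSolution (timeTranslate g s) x y₀ τ‖ ≤ c := by
    intro s
    obtain ⟨hy, hy0⟩ := hdis.layerSolution_spec (timeTranslate_mem_hull (self_mem_hull g) s) x y₀
    have := H x hx s _ hy.of_timeTranslate (by rwa [sub_self, hy0]) τ hτ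
    rwa [add_sub_cancel_right] at this
  refine le_of_forall_pos_le_add fun e he => ?_
  obtain ⟨hy, hy0⟩ := hdis.layerSolution_spec h.2 x y₀
  have hev := hy.eventually_norm_sub_lt (hreg.lipschitz_of_mem_hull h.2 x) τ he
  rw [hy0] at hev
  have hcont : Continuous fun h' : FastField n m => ((h', x, y₀) :
    FastField n m × Euc n × Euc m) := by fun_prop
  -- For this fixed `τ`, a translate close enough to `h` has a solution `e`-close at time `τ`, so
  -- the bound survives the limit with the same `T`.
  obtain ⟨_, hk, s, rfl⟩ := mem_closure_iff_nhds.1 h.2 _ (hcont.continuousAt.eventually hev)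
  obtain ⟨hz, hz0⟩ := hdis.layerSolution_spec (timeTranslate_mem_hull (self_mem_hull g) s) x y₀
  have h1 := hk _ hz hz0 τ ⟨hT.trans hτ, le_rfl⟩
  have h2 := htr s
  have h3 := norm_le_norm_add_norm_sub (layerSolution (timeTranslate g s) x y₀ τ)
    (layerSolution h.1 x y₀ τ)
  linarith

/-! ### Compatible metrics -/

theorem IsCompatibleMetric.continuous {X : Type*} [TopologicalSpace X] {d : X → X → ℝ}
    (hd : IsCompatibleMetric d) : Continuous fun p : X × X => d p.1 p.2 := by
  obtain ⟨M, rfl, hM⟩ := hd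
  simp only [← hM]
  exact continuous_dist

theorem IsCompatibleMetric.self {X : Type*} [TopologicalSpace X] {d : X → X → ℝ}
    (hd : IsCompatibleMetric d) (a : X) : d a a = 0 := by
  obtain ⟨M, -, hM⟩ := hd
  rw [← hM, dist_self]

theorem IsCompatibleMetric.nonneg {X : Type*} [TopologicalSpace X] {d : X → X → ℝ}
    (hd : IsCompatibleMetric d) (a b : X) : 0 ≤ d a b := by
  obtain ⟨M, -, hM⟩ := hd
  rw [← hM]
  exact dist_nonneg

theorem IsCompatibleMetric.eq_of_le_zero {X : Type*} [TopologicalSpace X] {d : X → X → ℝ}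
    (hd : IsCompatibleMetric d) {a b : X} (h : d a b ≤ 0) : a = b := by
  obtain ⟨M, -, hM⟩ := hd
  rw [← hM] at h
  exact dist_le_zero.1 h

theorem IsCompatibleMetric.triangle {X : Type*} [TopologicalSpace X] {d : X → X → ℝ}
    (hd : IsCompatibleMetric d) (a b c : X) : d a c ≤ d a b + d b c := by
  obtain ⟨M, -, hM⟩ := hd
  simp only [← hM]
  exact dist_triangle _ _ _

theorem continuous_prodDist {d : hull g → hull g → ℝ} (hd : IsCompatibleMetric d) :
    Continuous fun p : (hull g × Euc n × Euc m) × (hull g × Euc n × Euc m) =>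
      prodDist d p.1 p.2 := by
  have h1 : Continuous fun p : (hull g × Euc n × Euc m) × (hull g × Euc n × Euc m) =>
      (p.1.1, p.2.1) := by fun_prop
  exact (hd.continuous.comp h1).max (by fun_prop)

/-! ### Existence of the global attractor -/

theorem exists_isGlobalAttractor (hreg : RegularityAssumption f g)
    (hdis : DissipativityAssumption g) {d : hull g → hull g → ℝ} (hd : IsCompatibleMetric d)
    {K₀ : Set (Euc n)} (hK₀ : IsCompact K₀) : ∃ A, IsGlobalAttractor g d K₀ A := by
  obtain ⟨c, hc, hult⟩ := exists_layerSolution_ultimate_bound hreg hdis hK₀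
  set B : Set (hull g × Euc n × Euc m) := univ ×ˢ K₀ ×ˢ Metric.closedBall 0 c
  have hB : IsCompact B :=
    (isCompact_univ_hull hreg).prod (hK₀.prod (isCompact_closedBall _ _))
  have habs : ∀ D : Set (Euc m), Bornology.IsBounded D → ∃ T : ℝ, 0 ≤ T ∧ ∀ s, T ≤ s →
      MapsTo (layeredSemiflow g s) (univ ×ˢ K₀ ×ˢ D) B := by
    intro D hD
    obtain ⟨ρ, hρ, hDρ⟩ := hD.exists_pos_norm_le
    obtain ⟨T, hT, H⟩ := hult ρ hρ
    refine ⟨T, hT, fun s hs p hp => ⟨trivial, hp.2.1, mem_closedBall_zero_iff.2 ?_⟩⟩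
    exact H p.1 p.2.1 hp.2.1 p.2.2 (hDρ _ hp.2.2) s hs
  obtain ⟨T, hT, hmaps⟩ := habs _ Metric.isBounded_closedBall
  obtain ⟨A, hAB, hAc, hAinv, hA⟩ := exists_isCompact_invariant_subset
    (fun t ht => continuous_layeredSemiflow hreg hdis ht)
    (fun s hs t ht => layeredSemiflow_add hreg hdis hs ht) hB hT hmaps
  refine ⟨A, fun p hp => (hAB hp).2.1, hAc, hAinv, fun D hD => ?_⟩
  rw [ENNReal.tendsto_nhds_zero]
  intro e he
  obtain ⟨e', he', hee⟩ := ENNReal.lt_iff_exists_nnreal_btwn.1 he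
  obtain ⟨T', hT', hmapsD⟩ := habs D hD
  have hU : IsOpen (⋃ a ∈ A, {p | prodDist d p a < e'}) := by
    refine isOpen_biUnion fun a _ => ?_
    exact isOpen_lt ((continuous_prodDist hd).comp (by fun_prop : Continuous fun p => (p, a)))
      continuous_const
  obtain ⟨s, hs, hsU⟩ := hA _ hU fun a ha => by
    refine mem_biUnion ha ?_
    simpa [prodDist, hd.self] using he'
  filter_upwards [eventually_ge_atTop (s + T')] with τ hτ
  refine iSup₂_le ?_
  rintro _ ⟨p, hp, rfl⟩
  have hmem : layeredSemiflow g τ p ∈ layeredSemiflow g s '' B := by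
    -- The motion is absorbed by `B` during `τ - s ≥ T'`, and the last `s` units carry `B` into the
    -- neighbourhood of `A`.
    refine ⟨layeredSemiflow g (τ - s) p, hmapsD _ (by linarith) hp, ?_⟩
    rw [← layeredSemiflow_add hreg hdis hs (by linarith), add_sub_cancel]
  obtain ⟨a, ha, hpa⟩ := mem_iUnion₂.1 (hsU hmem)
  refine (iInf₂_le a ha).trans (le_trans ?_ hee.le)
  rw [← ENNReal.ofReal_coe_nnreal]
  exact ENNReal.ofReal_le_ofReal (le_of_lt hpa)

end SlowFast

namespace SlowFast

variable {n m : ℕ} {f : Euc n → Euc m → Euc n} {g : FastField n m}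

theorem IsCompatibleMetric.comm {X : Type*} [TopologicalSpace X] {d : X → X → ℝ}
    (hd : IsCompatibleMetric d) (a b : X) : d a b = d b a := by
  obtain ⟨M, -, hM⟩ := hd
  simp only [← hM]
  exact dist_comm _ _

/-! ### Comparison of the fast motion with the layer equations -/

/-- Solutions of `y' = g(u(s), y, s + a)` with `u` uniformly close to a constant stay close to the
corresponding layer solution, uniformly in the time shift `a`. -/
theorem exists_forall_norm_sub_layerSolution_lt (hreg : RegularityAssumption f g)
    (hdis : DissipativityAssumption g) {K₀ : Set (Euc n)} (hK₀ : IsCompact K₀) (ρ S : ℝ)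
    {e : ℝ} (he : 0 < e) :
    ∃ δ > 0, ∀ (a T : ℝ) (u : ℝ → Euc n) (z : ℝ → Euc m) (x : Euc n), T ≤ S → x ∈ K₀ →
      ‖z 0‖ ≤ ρ → ContinuousOn z (Icc 0 T) →
      (∀ s ∈ Ico 0 T, HasDerivWithinAt z (g ((u s, z s), s + a)) (Ici s) s) →
      (∀ s ∈ Ico 0 T, u s ∈ K₀ ∧ ‖u s - x‖ < δ) →
      ∀ s ∈ Icc 0 T, ‖z s - layerSolution (timeTranslate g a) x (z 0) s‖ < e := by
  obtain ⟨R, hR⟩ := exists_layerSolution_bound hreg hdis hK₀ ρ S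
  -- The ball contains the layer solution and, until the distance reaches `e`, also `z`. The
  -- constants `L` and `δ` taken on it are uniform in time, hence independent of `a`.
  have hK : IsCompact (Metric.closedBall (0 : Euc m) (R + e)) := isCompact_closedBall _ _
  obtain ⟨L, hL⟩ := hreg.lipschitz_g K₀ hK₀ _ hK
  obtain ⟨μ, hμ, hG⟩ := exists_gronwallBound_lt (lt_of_lt_of_le one_pos (le_max_right L 1)) he S
  obtain ⟨δ, hδ, hu⟩ := Metric.uniformContinuousOn_iff.1
    (hreg.uniformContinuous_g _ (hK₀.prod hK)) μ hμ
  refine ⟨δ, hδ, fun a T u z x hTS hx hz0 hzc hz hux => ?_⟩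
  have hmem : timeTranslate g a ∈ hull g := timeTranslate_mem_hull (self_mem_hull g) a
  obtain ⟨hy, hy0⟩ := hdis.layerSolution_spec hmem x (z 0)
  have hyR : ∀ s ∈ Icc 0 T, ‖layerSolution (timeTranslate g a) x (z 0) s‖ ≤ R := fun s hs =>
    hR ⟨_, hmem⟩ x hx _ hz0 s ⟨hs.1, hs.2.trans hTS⟩
  generalize layerSolution (timeTranslate g a) x (z 0) = y at *
  refine norm_sub_lt_of_norm_deriv_sub_le (L := max L 1) (μ := μ)
    (hy.continuousOn.mono Icc_subset_Ici_self) hzc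
    (fun s hs => (hy s hs.1).mono (Ici_subset_Ici.2 hs.1)) hz (by simp [hy0, hμ.le])
    ?_ (fun s hs => hG s ⟨hs.1, hs.2.trans hTS⟩)
  intro s hs hzs
  have hyR := hyR s ⟨hs.1, hs.2.le⟩
  have hmy : y s ∈ Metric.closedBall (0 : Euc m) (R + e) :=
    mem_closedBall_zero_iff.2 (by linarith)
  have hmz : z s ∈ Metric.closedBall (0 : Euc m) (R + e) := by
    refine mem_closedBall_zero_iff.2 ?_
    have := norm_le_norm_add_norm_sub' (z s) (y s)
    linarith
  obtain ⟨hus, husx⟩ := hux s hs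
  have h1 : ‖g ((u s, z s), s + a) - g ((x, z s), s + a)‖ ≤ μ := by
    rw [← dist_eq_norm]
    refine (hu ((u s, z s), s + a) (mk_mem_prod (mk_mem_prod hus hmz) (mem_univ _))
      ((x, z s), s + a) (mk_mem_prod (mk_mem_prod hx hmz) (mem_univ _)) ?_).le
    rw [Prod.dist_eq, Prod.dist_eq]
    exact max_lt (max_lt (by rwa [dist_eq_norm]) (by rwa [dist_self])) (by rwa [dist_self])
  calc ‖g ((u s, z s), s + a) - g ((x, y s), s + a)‖
      ≤ ‖g ((u s, z s), s + a) - g ((x, z s), s + a)‖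
          + ‖g ((x, z s), s + a) - g ((x, y s), s + a)‖ :=
        norm_sub_le_norm_sub_add_norm_sub _ _ _
    _ ≤ μ + max L 1 * ‖z s - y s‖ := by
        refine add_le_add h1 ((hL _ hmz _ hmy x hx _).trans ?_)
        gcongr
        exact le_max_left _ _
    _ = _ := add_comm _ _

theorem IsSlowFastSolution.continuousOn_slow {ξ : Euc n} {η : Euc m} {t₀ ε : ℝ} {x : ℝ → Euc n}
    {y : ℝ → Euc m} (h : IsSlowFastSolution f g ξ η t₀ ε x y) : ContinuousOn x (Icc 0 t₀) :=
  fun t ht => (h.slow t ht).continuousWithinAt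

/-- The fast equation in the fast time, started at the fast time `a`. -/
theorem IsSlowFastSolution.hasDerivWithinAt_fast {ξ : Euc n} {η : Euc m} {t₀ ε : ℝ}
    {x : ℝ → Euc n} {y : ℝ → Euc m} (h : IsSlowFastSolution f g ξ η t₀ ε x y) (hε : 0 < ε)
    {a : ℝ} {s : ℝ} (hs : 0 ≤ a + s) (hs' : a + s < t₀ / ε) :
    HasDerivWithinAt (fun s => y (ε * (a + s)))
      (g ((x (ε * (a + s)), y (ε * (a + s))), s + a)) (Ici s) s := by
  have hlt : ε * (a + s) < t₀ := by rwa [lt_div_iff₀' hε] at hs'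
  have h0 : 0 ≤ ε * (a + s) := mul_nonneg hε.le hs
  obtain ⟨v, hv, hvg⟩ := h.fast (ε * (a + s)) ⟨h0, hlt.le⟩
  have hv' : HasDerivWithinAt y v (Ici (ε * (a + s))) (ε * (a + s)) :=
    hv.mono_of_mem_nhdsWithin (Icc_mem_nhdsGE_of_mem ⟨h0, hlt⟩)
  have haff : HasDerivWithinAt (fun s : ℝ => ε * (a + s)) ε (Ici s) s := by
    simpa using! (((hasDerivAt_id s).const_add a).const_mul ε).hasDerivWithinAt
  have := hv'.scomp s haff (fun u hu => mul_le_mul_of_nonneg_left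
    (by simpa using hu) hε.le)
  rw [hvg, mul_div_cancel_left₀ _ hε.ne', add_comm a s] at this
  simpa [Function.comp_def, add_comm] using! this

theorem IsSlowFastSolution.continuousOn_fast {ξ : Euc n} {η : Euc m} {t₀ ε : ℝ}
    {x : ℝ → Euc n} {y : ℝ → Euc m} (h : IsSlowFastSolution f g ξ η t₀ ε x y) :
    ContinuousOn y (Icc 0 t₀) := fun t ht => by
  obtain ⟨v, hv, -⟩ := h.fast t ht
  exact hv.continuousWithinAt

/-- A uniformly convergent sequence of continuous curves on `[0, t₀]` is eventually
equicontinuous. -/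
theorem eventually_norm_sub_lt_of_tendstoUniformlyOn {E : Type*} [NormedAddCommGroup E]
    {x : ℕ → ℝ → E} {x₀ : ℝ → E} {t₀ : ℝ} (hx : ∀ k, ContinuousOn (x k) (Icc 0 t₀))
    (hx₀ : TendstoUniformlyOn x x₀ atTop (Icc 0 t₀)) {δ : ℝ} (hδ : 0 < δ) :
    ∃ ω > 0, ∀ᶠ k in atTop, ∀ t ∈ Icc 0 t₀, ∀ t' ∈ Icc 0 t₀, |t - t'| < ω →
      ‖x k t - x k t'‖ < δ := by
  have hc : ContinuousOn x₀ (Icc 0 t₀) := hx₀.continuousOn (Frequently.of_forall hx)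
  obtain ⟨ω, hω, H⟩ := Metric.uniformContinuousOn_iff.1
    (isCompact_Icc.uniformContinuousOn_of_continuous hc) (δ / 3) (by positivity)
  refine ⟨ω, hω, ?_⟩
  filter_upwards [Metric.tendstoUniformlyOn_iff.1 hx₀ (δ / 3) (by positivity)] with k hk t ht t' ht'
    htt
  have h1 := hk t ht
  have h2 := hk t' ht'
  have h3 := H t ht t' ht' htt
  rw [← dist_eq_norm]
  have h4 := dist_triangle4 (x k t) (x₀ t) (x₀ t') (x k t')
  rw [dist_comm] at h1
  linarith

theorem isCompact_tube {x₀ : ℝ → Euc n} {t₀ : ℝ} (hc : ContinuousOn x₀ (Icc 0 t₀)) (r : ℝ) :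
    IsCompact (tube x₀ t₀ r) := by
  have h : tube x₀ t₀ r =
      (fun p : ℝ × Euc n => x₀ p.1 + p.2) '' (Icc 0 t₀ ×ˢ Metric.closedBall 0 r) := by
    ext z
    constructor
    · rintro ⟨t, ht, x, hx, rfl⟩
      exact ⟨(t, x), ⟨ht, mem_closedBall_zero_iff.2 hx⟩, rfl⟩
    · rintro ⟨⟨t, x⟩, ⟨ht, hx⟩, rfl⟩
      exact ⟨t, ht, x, mem_closedBall_zero_iff.1 hx, rfl⟩
  rw [h]
  refine (isCompact_Icc.prod (isCompact_closedBall _ _)).image_of_continuousOn ?_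
  exact (hc.comp continuousOn_fst fun p hp => hp.1).add continuousOn_snd

theorem eventually_mem_tube {x : ℕ → ℝ → Euc n} {x₀ : ℝ → Euc n} {t₀ r : ℝ} (hr : 0 < r)
    (hx₀ : TendstoUniformlyOn x x₀ atTop (Icc 0 t₀)) :
    ∀ᶠ k in atTop, ∀ t ∈ Icc 0 t₀, x k t ∈ tube x₀ t₀ r := by
  filter_upwards [Metric.tendstoUniformlyOn_iff.1 hx₀ r hr] with k hk t ht
  refine ⟨t, ht, x k t - x₀ t, ?_, by abel⟩
  rw [← dist_eq_norm, dist_comm]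
  exact (hk t ht).le

/-! ### The fast motions along the sequence `ε k → 0`. -/

section Sequence

variable {ξ : Euc n} {η : Euc m} {t₀ r : ℝ} {ε : ℕ → ℝ} {x : ℕ → ℝ → Euc n} {y : ℕ → ℝ → Euc m}
  {x₀ : ℝ → Euc n}

theorem mul_mem_Icc_of_le_div {a t₀ ε : ℝ} (hε : 0 < ε) (ha : 0 ≤ a) (ha' : a ≤ t₀ / ε) :
    ε * a ∈ Icc 0 t₀ :=
  ⟨mul_nonneg hε.le ha, by rwa [le_div_iff₀' hε] at ha'⟩

/-- On fast time intervals of bounded length, the fast motion follows the layer solutions. -/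
theorem eventually_norm_sub_layerSolution_lt (hreg : RegularityAssumption f g)
    (hdis : DissipativityAssumption g) (hε_pos : ∀ k, 0 < ε k) (hε_lim : Tendsto ε atTop (𝓝 0))
    (hsol : ∀ k, IsSlowFastSolution f g ξ η t₀ (ε k) (x k) (y k))
    (hx₀ : TendstoUniformlyOn x x₀ atTop (Icc 0 t₀)) (hr : 0 < r) (ρ S : ℝ) {e : ℝ} (he : 0 < e) :
    ∀ᶠ k in atTop, ∀ a, 0 ≤ a → ∀ s ∈ Icc 0 S, a + s ≤ t₀ / ε k → ‖y k (ε k * a)‖ ≤ ρ →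
      ‖y k (ε k * (a + s)) - layerSolution (timeTranslate g a) (x k (ε k * a))
        (y k (ε k * a)) s‖ < e := by
  have hxc : ∀ k, ContinuousOn (x k) (Icc 0 t₀) := fun k => (hsol k).continuousOn_slow
  have hK₀ := isCompact_tube (hx₀.continuousOn (Frequently.of_forall hxc)) r
  obtain ⟨δ, hδ, H⟩ := exists_forall_norm_sub_layerSolution_lt hreg hdis hK₀ ρ S he
  obtain ⟨ω, hω, hω'⟩ := eventually_norm_sub_lt_of_tendstoUniformlyOn hxc hx₀ hδ
  have hsmall : ∀ᶠ k in atTop, ε k * S < ω := by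
    have : Tendsto (fun k => ε k * S) atTop (𝓝 0) := by simpa using hε_lim.mul_const S
    exact this.eventually_lt_const hω
  filter_upwards [hω', hsmall, eventually_mem_tube hr hx₀] with k hk hkS hkt a ha s hs has hya
  have hεk := hε_pos k
  have hI : ∀ u ∈ Icc 0 s, ε k * (a + u) ∈ Icc 0 t₀ := fun u hu =>
    mul_mem_Icc_of_le_div hεk (add_nonneg ha hu.1) (by linarith [hu.2])
  have hIa : ε k * a ∈ Icc 0 t₀ := by simpa using hI 0 ⟨le_rfl, hs.1⟩
  have key := H a s (fun u => x k (ε k * (a + u))) (fun u => y k (ε k * (a + u))) (x k (ε k * a))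
    hs.2 (hkt _ hIa) (by simpa using hya)
    ((hsol k).continuousOn_fast.comp (by fun_prop) hI)
    (fun u hu => (hsol k).hasDerivWithinAt_fast hεk (add_nonneg ha hu.1) (by linarith [hu.2]))
    (fun u hu => ⟨hkt _ (hI u ⟨hu.1, hu.2.le⟩), hk _ (hI u ⟨hu.1, hu.2.le⟩) _ hIa ?_⟩) s
    ⟨hs.1, le_rfl⟩
  · simpa using key
  · have h1 : ε k * (a + u) - ε k * a = ε k * u := by ring
    rw [h1, abs_of_nonneg (mul_nonneg hεk.le hu.1)]
    exact (mul_le_mul_of_nonneg_left (hu.2.le.trans hs.2) hεk.le).trans_lt hkS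

/-- The fast motions are eventually bounded, uniformly on the whole fast time interval. -/
theorem exists_eventually_norm_le (hreg : RegularityAssumption f g)
    (hdis : DissipativityAssumption g) (hε_pos : ∀ k, 0 < ε k) (hε_lim : Tendsto ε atTop (𝓝 0))
    (hsol : ∀ k, IsSlowFastSolution f g ξ η t₀ (ε k) (x k) (y k))
    (hx₀ : TendstoUniformlyOn x x₀ atTop (Icc 0 t₀)) (hr : 0 < r) :
    ∃ R : ℝ, ∀ᶠ k in atTop, ∀ τ, 0 ≤ τ → τ ≤ t₀ / ε k → ‖y k (ε k * τ)‖ ≤ R := by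
  have hxc : ∀ k, ContinuousOn (x k) (Icc 0 t₀) := fun k => (hsol k).continuousOn_slow
  have hK₀ := isCompact_tube (hx₀.continuousOn (Frequently.of_forall hxc)) r
  obtain ⟨c, hc, hult⟩ := exists_layerSolution_ultimate_bound hreg hdis hK₀
  -- The ball of radius `ρ` contains the initial value and is revisited at every multiple of `T`:
  -- the layer solution ends a window within `c`, and the comparison error is below 1.
  set ρ := max ‖η‖ (c + 1)
  have hρ : 0 < ρ := lt_of_lt_of_le (by linarith) (le_max_right _ _)
  obtain ⟨T', hT', hult⟩ := hult ρ hρ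
  set T := max T' 1
  have hT : 0 < T := lt_of_lt_of_le one_pos (le_max_right _ _)
  obtain ⟨R, hR⟩ := exists_layerSolution_bound hreg hdis hK₀ ρ T
  refine ⟨R + 1, ?_⟩
  filter_upwards [eventually_norm_sub_layerSolution_lt hreg hdis hε_pos hε_lim hsol hx₀ hr ρ T
    one_pos, eventually_mem_tube hr hx₀] with k hk hkt
  have hεk := hε_pos k
  have hmem : ∀ a : ℝ, timeTranslate g a ∈ hull g := timeTranslate_mem_hull (self_mem_hull g)
  have hstep : ∀ j : ℕ, j * T ≤ t₀ / ε k → ‖y k (ε k * (j * T))‖ ≤ ρ := by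
    intro j
    induction j with
    | zero =>
      intro _
      simp only [Nat.cast_zero, zero_mul, mul_zero, (hsol k).y_zero]
      exact le_max_left _ _
    | succ j ih =>
      intro hj
      have hj' : (j : ℝ) * T + T ≤ t₀ / ε k := by
        push_cast at hj
        linarith
      have hja : (0 : ℝ) ≤ j * T := by positivity
      have hjle : (j : ℝ) * T ≤ t₀ / ε k := by linarith
      have h1 := hk (j * T) hja T ⟨hT.le, le_rfl⟩ hj' (ih hjle)
      have h2 := hult ⟨_, hmem (j * T)⟩ _ (hkt _ (mul_mem_Icc_of_le_div hεk hja hjle)) _ (ih hjle)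
        T (le_max_left _ _)
      have h3 := norm_le_norm_add_norm_sub' (y k (ε k * (j * T + T)))
        (layerSolution (timeTranslate g (j * T)) (x k (ε k * (j * T))) (y k (ε k * (j * T))) T)
      have h4 : ((j + 1 : ℕ) : ℝ) * T = j * T + T := by push_cast; ring
      rw [h4]
      refine le_trans ?_ (le_max_right _ _)
      linarith
  intro τ hτ hτ'
  -- Between consecutive multiples of `T`, the layer solution from the last one is bounded by `R`.
  have hfl := Nat.floor_le (div_nonneg hτ hT.le)
  have hfl' := Nat.lt_floor_add_one (τ / T)
  set j := ⌊τ / T⌋₊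
  rw [le_div_iff₀ hT] at hfl
  rw [div_lt_iff₀ hT] at hfl'
  have hja : (0 : ℝ) ≤ j * T := by positivity
  have hjle : (j : ℝ) * T ≤ t₀ / ε k := by linarith
  have hs : τ - j * T ∈ Icc 0 T := ⟨by linarith, by linarith⟩
  have h1 := hk (j * T) hja (τ - j * T) hs (by linarith) (hstep j hjle)
  have h2 := hR ⟨_, hmem (j * T)⟩ _ (hkt _ (mul_mem_Icc_of_le_div hεk hja hjle)) _ (hstep j hjle)
    _ hs
  have h3 := norm_le_norm_add_norm_sub' (y k (ε k * (j * T + (τ - j * T))))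
    (layerSolution (timeTranslate g (j * T)) (x k (ε k * (j * T))) (y k (ε k * (j * T)))
      (τ - j * T))
  rw [add_sub_cancel] at h1 h3
  linarith

/-- The final states approach the attractor, in the maximum metric of the phase space. -/
theorem eventually_exists_prodDist_lt (hreg : RegularityAssumption f g)
    (hdis : DissipativityAssumption g) {d : hull g → hull g → ℝ} (hd : IsCompatibleMetric d)
    (ht₀ : 0 < t₀) (hε_pos : ∀ k, 0 < ε k) (hε_lim : Tendsto ε atTop (𝓝 0))
    (hsol : ∀ k, IsSlowFastSolution f g ξ η t₀ (ε k) (x k) (y k))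
    (hx₀ : TendstoUniformlyOn x x₀ atTop (Icc 0 t₀)) (hr : 0 < r)
    {A : Set (hull g × Euc n × Euc m)} (hA : IsGlobalAttractor g d (tube x₀ t₀ r) A)
    {e : ℝ} (he : 0 < e) :
    ∀ᶠ k in atTop, ∃ a ∈ A,
      prodDist d a (shift (t₀ / ε k) (base g), x₀ t₀, y k (ε k * (t₀ / ε k))) < e := by
  have hxc : ∀ k, ContinuousOn (x k) (Icc 0 t₀) := fun k => (hsol k).continuousOn_slow
  obtain ⟨R, hR⟩ := exists_eventually_norm_le hreg hdis hε_pos hε_lim hsol hx₀ hr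
  have he4 : 0 < e / 4 := by positivity
  -- `S` depends only on `R` and `e`, not on `k`; hence `ε k * S → 0` and the last window eventually
  -- fits into `[0, t₀ / ε k]`.
  obtain ⟨S, hS, hS0⟩ := ((ENNReal.tendsto_nhds_zero.1
    (hA.attracts _ (Metric.isBounded_closedBall (x := (0 : Euc m)) (r := R)))
    (ENNReal.ofReal (e / 4)) (ENNReal.ofReal_pos.2 he4)).and (eventually_ge_atTop 0)).exists
  obtain ⟨ω, hω, hω'⟩ := eventually_norm_sub_lt_of_tendstoUniformlyOn hxc hx₀ he4
  have hlim : Tendsto (fun k => ε k * S) atTop (𝓝 0) := by simpa using hε_lim.mul_const S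
  filter_upwards [hR, hω', hlim.eventually_lt_const hω, hlim.eventually_lt_const ht₀,
    eventually_mem_tube hr hx₀, Metric.tendstoUniformlyOn_iff.1 hx₀ (e / 4) he4,
    eventually_norm_sub_layerSolution_lt hreg hdis hε_pos hε_lim hsol hx₀ hr R S he4] with
    k hkR hkω hkS hkS' hkt hkx hkl
  have hεk := hε_pos k
  have hSle : S < t₀ / ε k := by rwa [lt_div_iff₀' hεk]
  have ha0 : 0 ≤ t₀ / ε k - S := by linarith
  set a := t₀ / ε k - S with hadef
  have haS : a + S = t₀ / ε k := by rw [hadef]; ring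
  have hIa : ε k * a ∈ Icc 0 t₀ := mul_mem_Icc_of_le_div hεk ha0 (by linarith)
  have ht₀m : t₀ ∈ Icc 0 t₀ := ⟨ht₀.le, le_rfl⟩
  have hya := hkR a ha0 (by linarith)
  have h1 := hkl a ha0 S ⟨hS0, le_rfl⟩ haS.le hya
  have hx1 : ‖x k (ε k * a) - x k t₀‖ < e / 4 := by
    refine hkω _ hIa _ ht₀m ?_
    have : ε k * a - t₀ = -(ε k * S) := by
      rw [hadef, mul_sub, mul_div_cancel₀ _ hεk.ne']
      ring
    rw [this, abs_neg, abs_of_nonneg (mul_nonneg hεk.le hS0)]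
    exact hkS
  have hx2 : ‖x₀ t₀ - x k t₀‖ < e / 4 := by
    rw [← dist_eq_norm]
    exact hkx t₀ ht₀m
  set p : hull g × Euc n × Euc m := (shift a (base g), x k (ε k * a), y k (ε k * a))
  have hpm : layeredSemiflow g S p ∈ layeredSemiflow g S '' (univ ×ˢ tube x₀ t₀ r ×ˢ
      Metric.closedBall (0 : Euc m) R) :=
    mem_image_of_mem _ ⟨trivial, hkt _ hIa, mem_closedBall_zero_iff.2 hya⟩
  have hinf : (⨅ b ∈ A, ENNReal.ofReal (prodDist d (layeredSemiflow g S p) b))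
      < ENNReal.ofReal (e / 2) :=
    ((le_iSup₂ (f := fun q (_ : q ∈ layeredSemiflow g S '' (univ ×ˢ tube x₀ t₀ r ×ˢ
      Metric.closedBall (0 : Euc m) R)) => ⨅ b ∈ A, ENNReal.ofReal (prodDist d q b)) _ hpm).trans
      hS).trans_lt ((ENNReal.ofReal_lt_ofReal_iff (by positivity)).2 (by linarith))
  simp only [iInf_lt_iff, exists_prop] at hinf
  obtain ⟨b, hb, hpb⟩ := hinf
  rw [ENNReal.ofReal_lt_ofReal_iff (by positivity)] at hpb
  obtain ⟨hb1, hb2⟩ := max_lt_iff.1 hpb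
  obtain ⟨hb2, hb3⟩ := max_lt_iff.1 hb2
  have hb1 : d (shift S (shift a (base g))) b.1 < e / 2 := hb1
  have hb2 : ‖x k (ε k * a) - b.2.1‖ < e / 2 := hb2
  have hb3 : ‖layerSolution (timeTranslate g a) (x k (ε k * a)) (y k (ε k * a)) S - b.2.2‖
    < e / 2 := hb3
  -- The hull component has no shadowing error since `a + S = t₀ / ε k`. The slow one adds two
  -- errors `e / 4` (motion in the window, distance to `x₀`), the fast one a single `e / 4`.
  refine ⟨b, hb, max_lt ?_ (max_lt ?_ ?_)⟩
  · rw [shift_add, add_comm S a, haS, hd.comm] at hb1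
    simp only
    linarith
  · simp only
    have h5 := dist_triangle4 b.2.1 (x k (ε k * a)) (x k t₀) (x₀ t₀)
    simp only [dist_eq_norm] at h5
    rw [norm_sub_rev b.2.1 (x k _), norm_sub_rev (x k t₀)] at h5
    linarith
  · simp only
    rw [haS, norm_sub_rev] at h1
    have h5 := dist_triangle b.2.2
      (layerSolution (timeTranslate g a) (x k (ε k * a)) (y k (ε k * a)) S)
      (y k (ε k * (t₀ / ε k)))
    simp only [dist_eq_norm] at h5
    rw [norm_sub_rev b.2.2 (layerSolution _ _ _ _)] at h5
    linarith

end Sequence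

/-! ### Inflated fibers of a compact set -/

theorem exists_isMinOn_prodDist {d : hull g → hull g → ℝ} (hd : IsCompatibleMetric d)
    {A : Set (hull g × Euc n × Euc m)} (hA : IsCompact A) (hne : A.Nonempty)
    (q : hull g × Euc n × Euc m) : ∃ a ∈ A, ∀ b ∈ A, prodDist d a q ≤ prodDist d b q :=
  hA.exists_isMinOn hne
    ((continuous_prodDist hd).comp (by fun_prop : Continuous fun p => (p, q))).continuousOn

/-- A single point `a` does both jobs: its base coordinates certify the inflation and its last
coordinate the distance. -/
theorem infEDist_inflatedFiber_le {d : hull g → hull g → ℝ} {K₀ : Set (Euc n)}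
    {A : Set (hull g × Euc n × Euc m)} (hAK : ∀ p ∈ A, p.2.1 ∈ K₀) {h : hull g} {x : Euc n}
    {y : Euc m} {a : hull g × Euc n × Euc m} (ha : a ∈ A) {δ : ℝ}
    (hδ : prodDist d a (h, x, y) ≤ δ) :
    Metric.infEDist y (inflatedFiber d K₀ A h x δ) ≤ ENNReal.ofReal δ := by
  obtain ⟨h1, h2⟩ := max_le_iff.1 hδ
  obtain ⟨h2, h3⟩ := max_le_iff.1 h2
  have hmem : a.2.2 ∈ inflatedFiber d K₀ A h x δ := ⟨a.1, a.2.1, hAK a ha, max_le h1 h2, ha⟩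
  refine (Metric.infEDist_le_edist_of_mem hmem).trans ?_
  rw [edist_comm, edist_dist, dist_eq_norm]
  exact ENNReal.ofReal_le_ofReal h3

/-- An admissible `δ` yields, up to `e`, a point of `A` within `δ + e` in the maximum metric. -/
theorem le_of_mem_admissibleRadii {d : hull g → hull g → ℝ} {K₀ : Set (Euc n)}
    {A : Set (hull g × Euc n × Euc m)} {h : hull g} {x : Euc n} {y : Euc m} {c δ : ℝ}
    (hc : ∀ b ∈ A, c ≤ prodDist d b (h, x, y)) (hδ : δ ∈ admissibleRadii d K₀ A h x y) :
    c ≤ δ := by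
  refine le_of_forall_pos_le_add fun e he => ?_
  have hlt : Metric.infEDist y (inflatedFiber d K₀ A h x δ) < ENNReal.ofReal (δ + e) :=
    hδ.2.trans_lt ((ENNReal.ofReal_lt_ofReal_iff (by linarith [hδ.1])).2 (by linarith))
  obtain ⟨y', ⟨h', x', -, hmax, hmem⟩, hy'⟩ := Metric.infEDist_lt_iff.1 hlt
  rw [edist_comm, edist_dist, ENNReal.ofReal_lt_ofReal_iff (by linarith [hδ.1]), dist_eq_norm]
    at hy'
  obtain ⟨h1, h2⟩ := max_le_iff.1 hmax
  exact (hc _ hmem).trans (max_le (by simp only; linarith) (max_le (by simp only; linarith) hy'.le))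

theorem sInf_admissibleRadii {d : hull g → hull g → ℝ} (hd : IsCompatibleMetric d)
    {K₀ : Set (Euc n)} {A : Set (hull g × Euc n × Euc m)} (hAK : ∀ p ∈ A, p.2.1 ∈ K₀)
    {h : hull g} {x : Euc n} {y : Euc m} {a : hull g × Euc n × Euc m} (ha : a ∈ A)
    (hmin : ∀ b ∈ A, prodDist d a (h, x, y) ≤ prodDist d b (h, x, y)) :
    (admissibleRadii d K₀ A h x y).Nonempty ∧
      sInf (admissibleRadii d K₀ A h x y) = prodDist d a (h, x, y) := by
  have hnn : 0 ≤ prodDist d a (h, x, y) := le_max_of_le_left (hd.nonneg _ _)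
  -- The slack `e` is needed because admissible radii are positive, whereas the distance to `A` may
  -- vanish.
  have hmem : ∀ e > 0, prodDist d a (h, x, y) + e ∈ admissibleRadii d K₀ A h x y := fun e he =>
    ⟨by linarith, infEDist_inflatedFiber_le hAK ha (by linarith)⟩
  have hne : (admissibleRadii d K₀ A h x y).Nonempty := ⟨_, hmem 1 one_pos⟩
  refine ⟨hne, le_antisymm (le_of_forall_pos_le_add fun e he => csInf_le ⟨0, fun δ hδ => hδ.1.le⟩
    (hmem e he)) (le_csInf hne fun δ hδ => le_of_mem_admissibleRadii hmin hδ)⟩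

/-- Upper semicontinuity of the fibers of a compact set. -/
theorem exists_forall_infEDist_fiber_lt {d : hull g → hull g → ℝ} (hd : IsCompatibleMetric d)
    {A : Set (hull g × Euc n × Euc m)} (hA : IsCompact A) (h : hull g) (x : Euc n) {e : ℝ≥0∞}
    (he : 0 < e) :
    ∃ δ > 0, ∀ a ∈ A, max (d a.1 h) ‖a.2.1 - x‖ < δ → Metric.infEDist a.2.2 (fiber A h x) < e := by
  have hN : IsCompact (A ∩ {a | e ≤ Metric.infEDist a.2.2 (fiber A h x)}) := by
    refine hA.inter_right (isClosed_le continuous_const ?_)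
    exact Metric.continuous_infEDist.comp (by fun_prop)
  rcases (A ∩ {a | e ≤ Metric.infEDist a.2.2 (fiber A h x)}).eq_empty_or_nonempty with hem | hne
  · refine ⟨1, one_pos, fun a ha _ => ?_⟩
    by_contra! hcon
    exact (hem ▸ ⟨ha, hcon⟩ : a ∈ (∅ : Set _))
  -- The least base distance over the points of `A` lying at least `e` off the fiber serves as `δ`;
  -- were it zero, the minimizer would lie in the fiber. An empty fiber is covered as well.
  · have hc : Continuous fun a : hull g × Euc n × Euc m => max (d a.1 h) ‖a.2.1 - x‖ :=
      (hd.continuous.comp (by fun_prop :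
        Continuous fun a : hull g × Euc n × Euc m => (a.1, h))).max (by fun_prop)
    obtain ⟨a, ⟨ha, hae⟩, hmin⟩ := hN.exists_isMinOn hne hc.continuousOn
    refine ⟨max (d a.1 h) ‖a.2.1 - x‖, ?_, fun b hb hlt => ?_⟩
    · by_contra! hcon
      obtain ⟨h1, h2⟩ := max_le_iff.1 hcon
      have h1 := hd.eq_of_le_zero h1
      have h2 := sub_eq_zero.1 (norm_le_zero_iff.1 h2)
      have hmem : a.2.2 ∈ fiber A h x := by
        rw [fiber, ← h1, ← h2]
        exact ha
      have hae : e ≤ Metric.infEDist a.2.2 (fiber A h x) := hae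
      rw [Metric.infEDist_zero_of_mem hmem] at hae
      exact absurd he (not_lt.2 hae)
    · by_contra! hcon
      exact absurd hlt (not_lt.2 (hmin ⟨hb, hcon⟩))

end SlowFast

/-! ### Assembly of the theorem. -/

theorem theorem4p4 {n m : ℕ} (f : Euc n → Euc m → Euc n) (g : FastField n m)
    (hreg : SlowFast.RegularityAssumption f g) (hdis : SlowFast.DissipativityAssumption g)
    (d : SlowFast.hull g → SlowFast.hull g → ℝ) (hd : SlowFast.IsCompatibleMetric d)
    (ξ : Euc n) (η : Euc m) (t₀ : ℝ) (ht₀ : 0 < t₀)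
    (ε : ℕ → ℝ) (hε_pos : ∀ k, 0 < ε k) (hε_lim : Tendsto ε atTop (𝓝 0))
    (x : ℕ → ℝ → Euc n) (y : ℕ → ℝ → Euc m)
    (hsol : ∀ k, SlowFast.IsSlowFastSolution f g ξ η t₀ (ε k) (x k) (y k))
    (x₀ : ℝ → Euc n) (hx₀ : TendstoUniformlyOn x x₀ atTop (Icc 0 t₀))
    (r : ℝ) (hr : 0 < r) (K₀ : Set (Euc n)) (hK₀ : K₀ = SlowFast.tube x₀ t₀ r)
    (yfin : ℕ → Euc m) (hyfin : ∀ k, yfin k = SlowFast.inFastTime (ε k) (y k) (t₀ / ε k))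
    (gfin : ℕ → SlowFast.hull g)
    (hgfin : ∀ k, gfin k = SlowFast.shift (t₀ / ε k) (SlowFast.base g)) :
    (∃ A, SlowFast.IsGlobalAttractor g d K₀ A) ∧
    ∀ A, SlowFast.IsGlobalAttractor g d K₀ A →
    ∀ δ : ℕ → ℝ, (∀ k, δ k =
        sInf (SlowFast.admissibleRadii d K₀ A (gfin k) (x₀ t₀) (yfin k))) →
      (∀ k, (SlowFast.admissibleRadii d K₀ A (gfin k) (x₀ t₀) (yfin k)).Nonempty) ∧
      Tendsto δ atTop (𝓝 0) ∧
      Tendsto (fun k => Metric.infEDist (yfin k)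
        (SlowFast.inflatedFiber d K₀ A (gfin k) (x₀ t₀) (δ k))) atTop (𝓝 0) ∧
      ∀ h₀ : SlowFast.hull g, Tendsto gfin atTop (𝓝 h₀) →
        h₀ ∈ SlowFast.omegaSet g ∧
        Tendsto (fun k => Metric.infEDist (yfin k) (SlowFast.fiber A h₀ (x₀ t₀)))
          atTop (𝓝 0) := by
  subst hK₀
  have hK₀ := SlowFast.isCompact_tube
    (hx₀.continuousOn (Frequently.of_forall fun k => (hsol k).continuousOn_slow)) r
  refine ⟨SlowFast.exists_isGlobalAttractor hreg hdis hd hK₀, fun A hA δ hδ => ?_⟩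
  have hnear : ∀ e > 0, ∀ᶠ k in atTop, ∃ a ∈ A,
      SlowFast.prodDist d a (gfin k, x₀ t₀, yfin k) < e := by
    intro e he
    filter_upwards [SlowFast.eventually_exists_prodDist_lt hreg hdis hd ht₀ hε_pos hε_lim hsol hx₀
      hr hA he] with k hk
    rw [hgfin, hyfin]
    exact hk
  have hne : A.Nonempty := by
    obtain ⟨k, a, ha, -⟩ := (hnear 1 one_pos).exists
    exact ⟨a, ha⟩
  choose a haA hmin using fun k =>
    SlowFast.exists_isMinOn_prodDist hd hA.compact hne (gfin k, x₀ t₀, yfin k)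
  have hδa : ∀ k, δ k = SlowFast.prodDist d (a k) (gfin k, x₀ t₀, yfin k) := fun k =>
    (hδ k).trans (SlowFast.sInf_admissibleRadii hd hA.subset (haA k) (hmin k)).2
  have hδ0 : Tendsto δ atTop (𝓝 0) := by
    refine Metric.tendsto_nhds.2 fun e he => ?_
    filter_upwards [hnear e he] with k hk
    obtain ⟨b, hb, hbe⟩ := hk
    have hnn : 0 ≤ SlowFast.prodDist d (a k) (gfin k, x₀ t₀, yfin k) :=
      le_max_of_le_left (hd.nonneg _ _)
    rw [Real.dist_eq, sub_zero, hδa, abs_of_nonneg hnn]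
    exact (hmin k b hb).trans_lt hbe
  refine ⟨fun k => (SlowFast.sInf_admissibleRadii hd hA.subset (haA k) (hmin k)).1, hδ0, ?_,
    fun h₀ hh₀ => ⟨?_, ?_⟩⟩
  -- The minimum over `A` is attained, so the distance bound holds at the infimum `δ k` itself.
  · refine tendsto_of_tendsto_of_tendsto_of_le_of_le tendsto_const_nhds
      (by simpa using ENNReal.tendsto_ofReal hδ0) (fun _ => zero_le) (fun k => ?_)
    exact SlowFast.infEDist_inflatedFiber_le hA.subset (haA k) (hδa k).ge
  · rw [SlowFast.omegaSet, mem_omegaLimit_singleton_iff_mapClusterPt]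
    have htop : Tendsto (fun k => t₀ / ε k) atTop atTop := by
      have : Tendsto ε atTop (𝓝[>] 0) :=
        tendsto_nhdsWithin_iff.2 ⟨hε_lim, Eventually.of_forall hε_pos⟩
      simpa only [div_eq_mul_inv] using! this.inv_tendsto_nhdsGT_zero.const_mul_atTop ht₀
    refine MapClusterPt.of_comp htop ?_
    have hcomp : (fun s => SlowFast.shift s (SlowFast.base g)) ∘ (fun k => t₀ / ε k) = gfin :=
      funext fun k => (hgfin k).symm
    rw [hcomp]
    exact hh₀.mapClusterPt
  · rw [ENNReal.tendsto_nhds_zero]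
    intro e he
    have he2 : 0 < e / 2 := ENNReal.half_pos he.ne'
    obtain ⟨ω, hω, H⟩ := SlowFast.exists_forall_infEDist_fiber_lt hd hA.compact h₀ (x₀ t₀) he2
    have hd0 : Tendsto (fun k => d (gfin k) h₀) atTop (𝓝 0) := by
      have := (hd.continuous.tendsto (h₀, h₀)).comp (hh₀.prodMk_nhds tendsto_const_nhds)
      simpa [hd.self] using! this
    have hδe : Tendsto (fun k => ENNReal.ofReal (δ k)) atTop (𝓝 0) := by
      simpa using ENNReal.tendsto_ofReal hδ0
    filter_upwards [hδ0.eventually_lt_const (half_pos hω), hd0.eventually_lt_const (half_pos hω),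
      hδe.eventually_lt_const he2] with k hk1 hk2 hk3
    have hle := (hδa k).ge
    obtain ⟨h1, h2⟩ := max_le_iff.1 hle
    obtain ⟨h2, h3⟩ := max_le_iff.1 h2
    simp only at h1 h2 h3
    -- The base of the nearest point is within `δ k + d (gfin k) h₀ < ω` of `(h₀, x₀ t₀)`.
    have h4 := H (a k) (haA k) (max_lt
      (by linarith [hd.triangle (a k).1 (gfin k) h₀]) (by linarith))
    have h5 : edist (yfin k) (a k).2.2 ≤ ENNReal.ofReal (δ k) := by
      rw [edist_comm, edist_dist, dist_eq_norm]
      exact ENNReal.ofReal_le_ofReal h3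
    calc Metric.infEDist (yfin k) (SlowFast.fiber A h₀ (x₀ t₀))
        ≤ Metric.infEDist (a k).2.2 (SlowFast.fiber A h₀ (x₀ t₀)) + edist (yfin k) (a k).2.2 :=
          Metric.infEDist_le_infEDist_add_edist
      _ ≤ e / 2 + e / 2 := add_le_add h4.le (h5.trans hk3.le)
      _ = e := ENNReal.add_halves e
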